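/- **Setting.** Let $\{0,1\}^*$ be the set of finite binary strings, $\lambda$ the empty string, $x\otimes y$ the concatenation of strings, and $\overline{\{0,1\}^*}=\{0,1\}^*\cup\{\infty\}$. A *computer* is a partial recursive function $C:\{0,1\}^*\to\{0,1\}^*$; we write $C(x)=\infty$ if $C$ is undefined at $x$, so that $C$ maps $\{0,1\}^*$ to $\overline{\{0,1\}^*}$. For a computer $C$ and $x\in\{0,1\}^*$, let $(C\stackrel{x}{\longrightarrow})$ be the computer $s\mapsto C(x\otimes s)$, and write $C\stackrel{x}{\longrightarrow}D$ if $D=(C\stackrel{x}{\longrightarrow})$. A set $\Phi$ of computers is *branching* if for every $C\in\Phi$: (i) $(C\stackrel{x\otimes y}{\longrightarrow})\in\Phi$ implies $(C\stackrel{x}{\longrightarrow})\in\Phi$, for all strings $x,y$; (ii) $(C\stackrel{x}{\longrightarrow})\in\Phi$ for some $x\ne\lambda$. For $C\in\Phi$ let $C^{-1}(\Phi)=\{x:(C\stackrel{x}{\longrightarrow})\in\Phi\}$, and define path probabilities on this tree by $\mu_{C^{-1}(\Phi)}(\lambda)=1$ and, for a bit $b$ with inverse $\bar b$ and $x\otimes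 b\in C^{-1}(\Phi)$, $$\mu_{C^{-1}(\Phi)}(x\otimes b)=\begin{cases}\tfrac12\,\mu_{C^{-1}(\Phi)}(x)&\text{if }x\otimes\bar b\in C^{-1}(\Phi),\\ \mu_{C^{-1}(\Phi)}(x)&\text{otherwise.}\end{cases}$$ For $n\ge 0$, $D\in\Phi$ and $s\in\overline{\{0,1\}^*}$, the $n$-step computer and string probabilities are $$\mu_C^{(n)}(D|\Phi)=\sum_{x\in\{0,1\}^n:\,C\stackrel{x}{\longrightarrow}D}\mu_{C^{-1}(\Phi)}(x),\qquad \mu_C^{(n)}(s|\Phi)=\sum_{x\in\{0,1\}^n\cap C^{-1}(\Phi):\,C(x)=s}\mu_{C^{-1}(\Phi)}(x).$$ The *emulation Markov process* of a branching set $\Phi$ is the Markov chain on $\Phi$ with transition probabilities $\mu_C^{(1)}(D|\Phi)$. The set $\Phi$ is *irreducible* if for all $C,D\in\Phi$ there is an $n\ge0$ with $\mu_C^{(n)}(D|\Phi)>0$; it is *aperiodic* if $\gcd\{n\ge1:\mu_C^{(n)}(C|\Phi)>0\}=1$ for every $C\in\Phi$. Finally, $\Phi$ is called *positive recurrent* if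 it is branching, irreducible and aperiodic, and every state of the emulation Markov process is positive recurrent, that is, the process started at the state returns to it with probability one and with finite mean return time. **Theorem 4.2 (Stationary Algorithmic String Probability).** Let $\Phi$ be a positive recurrent set of computers. For every $D\in\Phi$ the limit $\mu(D|\Phi)=\lim_{n\to\infty}\mu_C^{(n)}(D|\Phi)$ exists for every $C\in\Phi$ and does not depend on $C$. Moreover, for every $s\in\overline{\{0,1\}^*}$ the limit $$\mu(s|\Phi):=\lim_{n\to\infty}\mu_C^{(n)}(s|\Phi)$$ exists for every $C\in\Phi$ and does not depend on $C$, and $$\mu(s|\Phi)=\sum_{U\in\Phi}\mu(U|\Phi)\,\mu_U^{(0)}(s|\Phi)=\sum_{U\in\Phi:\,U(\lambda)=s}\mu(U|\Phi),$$ where both series converge. -/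

import Mathlib

open Filter Topology
open scoped ENNReal Classical

/-- A computer is a partial recursive function on finite binary strings. It is an extensional
object: two programs with the same input-output behaviour are the same computer. The value
`C.1 x : Part (List Bool)` is a string if `C` halts on `x`, and `Part.none` (written `∞` in the
literature) otherwise, so `Part (List Bool)` is the set of strings together with `∞`. -/
abbrev Computer : Type := {f : List Bool →. List Bool // Partrec f}

/-- The computer `D` that `C` emulates via `x`, given by `D s = C (x ⊗ s)` for all strings `s`,
where `⊗` is concatenation. -/
def Computer.emulated (C : Computer) (x : List Bool) : Computer :=
  ⟨fun s => C.1 (x ++ s),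
    C.2.comp (Computable.list_append.comp (Computable.const x) Computable.id)⟩

/-- Branching sets of computers. -/
structure IsBranchingSet (Φ : Set Computer) : Prop where
  prefix_mem : ∀ C ∈ Φ, ∀ x y : List Bool, C.emulated (x ++ y) ∈ Φ → C.emulated x ∈ Φ
  exists_mem : ∀ C ∈ Φ, ∃ x : List Bool, x ≠ [] ∧ C.emulated x ∈ Φ

/-- The `Φ`-tree of `C`: the set of all inputs that make `C` emulate an element of `Φ`. -/
def emulationTree (Φ : Set Computer) (C : Computer) : Set (List Bool) :=
  {x | C.emulated x ∈ Φ}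

/-- Auxiliary recursion for `pathProb`, with the path listed from its last bit to its first. -/
noncomputable def pathProbRev (T : Set (List Bool)) : List Bool → ℝ
  | [] => 1
  | b :: r => if r.reverse ++ [!b] ∈ T then (1 / 2) * pathProbRev T r else pathProbRev T r

/-- The path probability of `x` in the tree `T`: at every bifurcation on the way from the root
to `x` there is a factor `1 / 2`. It is only used for `x ∈ T`. -/
noncomputable def pathProb (T : Set (List Bool)) (x : List Bool) : ℝ :=
  pathProbRev T x.reverse

theorem pathProb_nil (T : Set (List Bool)) : pathProb T [] = 1 := rfl

theorem pathProb_append_singleton (T : Set (List Bool)) (x : List Bool) (b : Bool) :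
    pathProb T (x ++ [b]) =
      if x ++ [!b] ∈ T then (1 / 2) * pathProb T x else pathProb T x := by
  simp [pathProb, pathProbRev]

/-- The `n`-step computer probability of `D`: the probability of arriving at `D` on a random walk
of `n` steps on the `Φ`-tree of `C`. -/
noncomputable def computerProb (Φ : Set Computer) (C : Computer) (n : ℕ) (D : Computer) : ℝ :=
  ∑ x : List.Vector Bool n with C.emulated x.toList = D, pathProb (emulationTree Φ C) x.toList

/-- The `n`-step string probability of `s`: the probability of the output `s` at the end of a
random walk of `n` steps on the `Φ`-tree of `C`. -/
noncomputable def stringProb (Φ : Set Computer) (C : Computer) (n : ℕ) (s : Part (List Bool)) : ℝ :=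
  ∑ x : List.Vector Bool n with x.toList ∈ emulationTree Φ C ∧ C.1 x.toList = s,
    pathProb (emulationTree Φ C) x.toList

/-- The emulation matrix of `Φ`, the transition matrix of the emulation Markov process. -/
noncomputable def emulationMatrix (Φ : Set Computer) : Matrix Φ Φ ℝ :=
  fun C D => computerProb Φ C 1 D

/-- For a Markov chain on `S` with transition matrix `P`, the probability that the chain started
at `i` visits `j` at time `n`, and at no time `1, …, n - 1` before. It is `0` for `n = 0`. -/
noncomputable def firstPassageProb {S : Type*} (P : Matrix S S ℝ) (j : S) : ℕ → S → ℝ≥0∞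
  | 0, _ => 0
  | 1, i => ENNReal.ofReal (P i j)
  | n + 2, i =>
      ∑' k : S, if k = j then 0 else ENNReal.ofReal (P i k) * firstPassageProb P j (n + 1) k

/-- The state `j` of the Markov chain with transition matrix `P` is positive recurrent: started at
`j`, the chain returns to `j` with probability one, and the mean return time is finite. -/
def IsPositiveRecurrentState {S : Type*} (P : Matrix S S ℝ) (j : S) : Prop :=
  ∑' n : ℕ, firstPassageProb P j n j = 1 ∧ ∑' n : ℕ, (n : ℝ≥0∞) * firstPassageProb P j n j < ∞

/-- Any two states of the emulation Markov process communicate. -/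
def IsIrreducibleSet (Φ : Set Computer) : Prop :=
  ∀ C ∈ Φ, ∀ D ∈ Φ, ∃ n : ℕ, 0 < computerProb Φ C n D

/-- The period of `C`, with the value `0` if a return to `C` is impossible. -/
noncomputable def emulationPeriod (Φ : Set Computer) (C : Computer) : ℕ :=
  Nat.setGcd {n : ℕ | 1 ≤ n ∧ 0 < computerProb Φ C n C}

/-- Positive recurrent sets of computers. As usual in this setting, positive recurrent sets are
understood to be branching, irreducible and aperiodic as well. -/
structure IsPositiveRecurrentSet (Φ : Set Computer) : Prop where
  branching : IsBranchingSet Φ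
  irreducible : IsIrreducibleSet Φ
  aperiodic : ∀ C ∈ Φ, emulationPeriod Φ C = 1
  recurrent : ∀ C : Φ, IsPositiveRecurrentState (emulationMatrix Φ) C

/-! The part of the tree of `C` beyond `x` is the tree of `C.emulated x`, so path probabilities
multiply under concatenation (`pathProb_append`). Hence the computer probabilities are the step
probabilities of a Markov chain, and the string probability of `s` is the probability of the set of
computers with output `s` at the empty string. This set may be infinite, so convergence is needed on
every set of states.

A positive recurrent state `j` has a stationary law: the expected occupation of an excursion from
`j`, divided by the mean return time. For convergence, take two independent stationary starting
points and average the total variation distance of their laws at time `m`. This mean decreases in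
`m`, so its decrements vanish. Two chains both started at `j` are at distance zero, yet can be at
`x` and `y` after `n` steps; the decrement over `n` steps therefore dominates a positive multiple of
`tvDist p m x y` (`meanTVDist_add_le`). Aperiodicity and irreducibility supply a common `n` for any
`x` and `y`, so all laws merge, and they merge with the stationary one. -/

theorem ENNReal.tsum_tsub_tsum_le {α : Type*} (f g : α → ℝ≥0∞) :
    ∑' a, f a - ∑' a, g a ≤ ∑' a, (f a - g a) := by
  rw [tsub_le_iff_left, ← ENNReal.tsum_add]
  exact ENNReal.tsum_le_tsum fun a => le_add_tsub

theorem ENNReal.mul_tsub_mul_le (c a b : ℝ≥0∞) : c * a - c * b ≤ c * (a - b) := by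
  rw [tsub_le_iff_left, ← mul_add]
  gcongr
  exact le_add_tsub

theorem ENNReal.tsum_mul_tsum {α β : Type*} (f : α → ℝ≥0∞) (g : β → ℝ≥0∞) :
    ∑' q : α × β, f q.1 * g q.2 = (∑' a, f a) * ∑' b, g b := by
  rw [ENNReal.tsum_prod (f := fun a b => f a * g b)]
  simp_rw [ENNReal.tsum_mul_left, ENNReal.tsum_mul_right]

/-- Dominated convergence for counting measure, with the weights `w` as the bound. -/
theorem ENNReal.tendsto_tsum_mul_of_le_one {α : Type*} {w : α → ℝ≥0∞} (hw : ∑' a, w a ≠ ∞)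
    {u : ℕ → α → ℝ≥0∞} (hu : ∀ n a, u n a ≤ 1) (hlim : ∀ a, Tendsto (u · a) atTop (𝓝 0)) :
    Tendsto (fun n => ∑' a, w a * u n a) atTop (𝓝 0) := by
  let _ : MeasurableSpace α := ⊤
  have h := MeasureTheory.tendsto_lintegral_of_dominated_convergence
    (μ := MeasureTheory.Measure.count) (F := fun n a => w a * u n a) (f := fun _ => 0) w
    (fun n => measurable_from_top)
    (fun n => MeasureTheory.ae_of_all _ fun a => mul_le_of_le_one_right' (hu n a))
    (by rwa [MeasureTheory.lintegral_count])
    (MeasureTheory.ae_of_all _ fun a => by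
      have := ENNReal.Tendsto.const_mul (hlim a)
        (Or.inr (ENNReal.ne_top_of_tsum_ne_top hw a))
      simpa using this)
  simpa [MeasureTheory.lintegral_count] using h

/-! ### Convergence of Markov chains to a stationary law -/

/-- `p n x z` are the `n`-step transition probabilities of a Markov chain on `S`. -/
structure IsStepFamily {S : Type*} (p : ℕ → S → S → ℝ≥0∞) : Prop where
  zero : ∀ x z, p 0 x z = if z = x then 1 else 0
  add : ∀ m n x z, p (m + n) x z = ∑' y, p m x y * p n y z
  mass : ∀ n x, ∑' z, p n x z = 1

/-- The total variation distance of the laws at time `n` of the chains started at `x` and `y`. -/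
noncomputable def tvDist {S : Type*} (p : ℕ → S → S → ℝ≥0∞) (n : ℕ) (x y : S) : ℝ≥0∞ :=
  ∑' z, (p n x z - p n y z)

/-- The law `π` is stationary for the chain. -/
structure IsStationaryLaw {S : Type*} (p : ℕ → S → S → ℝ≥0∞) (π : S → ℝ≥0∞) : Prop where
  mass : ∑' x, π x = 1
  step : ∀ z, ∑' x, π x * p 1 x z = π z

section
variable {S : Type*} {p : ℕ → S → S → ℝ≥0∞} {π : S → ℝ≥0∞}

theorem IsStepFamily.pos_add (hp : IsStepFamily p) {m n : ℕ} {x y z : S} (h₁ : 0 < p m x y)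
    (h₂ : 0 < p n y z) : 0 < p (m + n) x z := by
  rw [hp.add]
  exact (ENNReal.mul_pos h₁.ne' h₂.ne').trans_le (ENNReal.le_tsum y)

theorem tvDist_self (n : ℕ) (x : S) : tvDist p n x x = 0 := by
  simp [tvDist]

theorem IsStepFamily.tvDist_le_one (hp : IsStepFamily p) (n : ℕ) (x y : S) :
    tvDist p n x y ≤ 1 := by
  rw [← hp.mass n x]
  exact ENNReal.tsum_le_tsum fun z => tsub_le_self

/-- Mixtures are at most as far apart as their components are on average. -/
theorem tsum_tsub_mixture_le (p : ℕ → S → S → ℝ≥0∞) (m : ℕ) {a b : S → ℝ≥0∞}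
    (ha : ∑' x, a x = 1) (hb : ∑' x, b x = 1) :
    ∑' z, (∑' x, a x * p m x z - ∑' y, b y * p m y z) ≤
      ∑' q : S × S, a q.1 * b q.2 * tvDist p m q.1 q.2 := by
  -- Multiplying by the total mass of the other law writes both mixtures over the same independent
  -- pairs.
  have h₁ : ∀ z, ∑' x, a x * p m x z = ∑' q : S × S, a q.1 * b q.2 * p m q.1 z := fun z => by
    have := ENNReal.tsum_mul_tsum (fun x => a x * p m x z) b
    rw [hb, mul_one] at this
    rw [← this]
    exact tsum_congr fun q => by ring
  have h₂ : ∀ z, ∑' y, b y * p m y z = ∑' q : S × S, a q.1 * b q.2 * p m q.2 z := fun z => by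
    have := ENNReal.tsum_mul_tsum a (fun y => b y * p m y z)
    rw [ha, one_mul] at this
    rw [← this]
    exact tsum_congr fun q => by ring
  calc _ ≤ ∑' z, ∑' q : S × S, a q.1 * b q.2 * (p m q.1 z - p m q.2 z) := by
        refine ENNReal.tsum_le_tsum fun z => ?_
        rw [h₁, h₂]
        exact (ENNReal.tsum_tsub_tsum_le _ _).trans
          (ENNReal.tsum_le_tsum fun q => ENNReal.mul_tsub_mul_le _ _ _)
    _ = _ := by
        rw [ENNReal.tsum_comm]
        exact tsum_congr fun q => by rw [ENNReal.tsum_mul_left, tvDist]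

/-- By the Markov property, the laws at time `n + m` are mixtures over the positions at time `n`. -/
theorem IsStepFamily.tvDist_add_le (hp : IsStepFamily p) (n m : ℕ) (x y : S) :
    tvDist p (n + m) x y ≤ ∑' q : S × S, p n x q.1 * p n y q.2 * tvDist p m q.1 q.2 := by
  refine le_trans (le_of_eq ?_) (tsum_tsub_mixture_le p m (hp.mass n x) (hp.mass n y))
  exact tsum_congr fun z => by rw [hp.add, hp.add]

theorem IsStationaryLaw.steps (hπ : IsStationaryLaw p π) (hp : IsStepFamily p) (n : ℕ) (z : S) :
    ∑' x, π x * p n x z = π z := by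
  induction n generalizing z with
  | zero => simp [hp.zero]
  | succ n ih =>
    calc ∑' x, π x * p (n + 1) x z = ∑' x, ∑' y, π x * p n x y * p 1 y z :=
          tsum_congr fun x => by
            rw [hp.add, ← ENNReal.tsum_mul_left]
            exact tsum_congr fun y => by ring
      _ = ∑' y, π y * p 1 y z := by
          rw [ENNReal.tsum_comm]
          exact tsum_congr fun y => by rw [ENNReal.tsum_mul_right, ih]
      _ = π z := hπ.step z

/-- The product of two copies of a stationary law is stationary for two independent chains. -/
theorem IsStationaryLaw.tsum_prod (hπ : IsStationaryLaw p π) (hp : IsStepFamily p) (n : ℕ)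
    (f : S × S → ℝ≥0∞) :
    ∑' w : S × S, π w.1 * π w.2 * ∑' q : S × S, p n w.1 q.1 * p n w.2 q.2 * f q =
      ∑' q : S × S, π q.1 * π q.2 * f q := by
  simp_rw [← ENNReal.tsum_mul_left]
  rw [ENNReal.tsum_comm]
  refine tsum_congr fun q => ?_
  rw [← hπ.steps hp n q.1, ← hπ.steps hp n q.2, ← ENNReal.tsum_mul_tsum, ← ENNReal.tsum_mul_right]
  exact tsum_congr fun w => by ring

/-- The mean distance at time `m` of two independent stationary starting points. -/
noncomputable def meanTVDist (p : ℕ → S → S → ℝ≥0∞) (π : S → ℝ≥0∞) (m : ℕ) : ℝ≥0∞ :=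
  ∑' w : S × S, π w.1 * π w.2 * tvDist p m w.1 w.2

theorem IsStationaryLaw.meanTVDist_le_one (hπ : IsStationaryLaw p π) (hp : IsStepFamily p)
    (m : ℕ) : meanTVDist p π m ≤ 1 := by
  calc meanTVDist p π m ≤ ∑' w : S × S, π w.1 * π w.2 :=
        ENNReal.tsum_le_tsum fun w => mul_le_of_le_one_right' (hp.tvDist_le_one _ _ _)
    _ = 1 := by rw [ENNReal.tsum_mul_tsum, hπ.mass, one_mul]

/-- The mean distance decreases in `n` steps at least by what a common start at `j` loses. -/
theorem IsStationaryLaw.meanTVDist_add_le (hπ : IsStationaryLaw p π) (hp : IsStepFamily p)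
    (n m : ℕ) (j x y : S) :
    meanTVDist p π (n + m) + π j * π j * (p n j x * p n j y) * tvDist p m x y ≤
      meanTVDist p π m := by
  set g : S × S → ℝ≥0∞ := fun w => ∑' q : S × S, p n w.1 q.1 * p n w.2 q.2 * tvDist p m q.1 q.2
    with hg
  -- At `w = (j, j)` the distance on the left vanishes, which leaves room for the single term `q =
  -- (x, y)` of `g`.
  have key : ∀ w : S × S, π w.1 * π w.2 * tvDist p (n + m) w.1 w.2 +
      (if w = (j, j) then π j * π j * (p n j x * p n j y) * tvDist p m x y else 0) ≤
        π w.1 * π w.2 * g w := by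
    intro w
    split_ifs with h
    · subst h
      rw [tvDist_self, mul_zero, zero_add, mul_assoc]
      gcongr
      exact ENNReal.le_tsum (f := fun q : S × S => p n j q.1 * p n j q.2 * tvDist p m q.1 q.2)
        (x, y)
    · rw [add_zero]
      gcongr
      exact hp.tvDist_add_le n m w.1 w.2
  have := ENNReal.tsum_le_tsum key
  rw [ENNReal.tsum_add, tsum_ite_eq, hπ.tsum_prod hp n (fun q => tvDist p m q.1 q.2)] at this
  exact this

/-- The decrements of the bounded antitone sequence `meanTVDist p π` tend to zero, and each of them
over `n` steps is at least a fixed positive multiple of `tvDist p m x y`. -/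
theorem IsStationaryLaw.tendsto_tvDist (hπ : IsStationaryLaw p π) (hp : IsStepFamily p)
    {j x y : S} (hj : 0 < π j) {n : ℕ} (hx : 0 < p n j x) (hy : 0 < p n j y) :
    Tendsto (fun m => tvDist p m x y) atTop (𝓝 0) := by
  have hanti : Antitone (meanTVDist p π) := antitone_nat_of_succ_le fun m => by
    rw [add_comm]
    exact le_self_add.trans (hπ.meanTVDist_add_le hp 1 m j j j)
  have hlim := tendsto_atTop_iInf hanti
  set L := ⨅ m, meanTVDist p π m
  have hL : L ≠ ∞ :=
    ((iInf_le _ 0).trans (hπ.meanTVDist_le_one hp 0)).trans_lt ENNReal.one_lt_top |>.ne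
  have hfin : ∀ m, meanTVDist p π m ≠ ∞ := fun m =>
    ((hπ.meanTVDist_le_one hp m).trans_lt ENNReal.one_lt_top).ne
  have hdiff : Tendsto (fun m => meanTVDist p π m - meanTVDist p π (m + n)) atTop (𝓝 0) := by
    have := ENNReal.Tendsto.sub hlim (hlim.comp (tendsto_add_atTop_nat n)) (Or.inl hL)
    simpa using this
  set c := π j * π j * (p n j x * p n j y) with hc
  have hc0 : c ≠ 0 := by simp [hc, hj.ne', hx.ne', hy.ne']
  have hpt : ∀ u v, p n u v ≠ ∞ := fun u v =>
    ENNReal.ne_top_of_tsum_ne_top (by rw [hp.mass n u]; exact ENNReal.one_ne_top) v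
  have hπt : π j ≠ ∞ :=
    ENNReal.ne_top_of_tsum_ne_top (by rw [hπ.mass]; exact ENNReal.one_ne_top) j
  have hct : c ≠ ∞ :=
    ENNReal.mul_ne_top (ENNReal.mul_ne_top hπt hπt) (ENNReal.mul_ne_top (hpt _ _) (hpt _ _))
  have hbound : ∀ m, tvDist p m x y ≤ c⁻¹ * (meanTVDist p π m - meanTVDist p π (m + n)) := by
    intro m
    rw [← ENNReal.mul_le_iff_le_inv hc0 hct]
    refine ENNReal.le_sub_of_add_le_left (hfin _) ?_
    rw [add_comm m n]
    exact hπ.meanTVDist_add_le hp n m j x y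
  refine tendsto_of_tendsto_of_tendsto_of_le_of_le tendsto_const_nhds ?_ (fun m => zero_le)
    hbound
  simpa using ENNReal.Tendsto.const_mul hdiff (Or.inr (ENNReal.inv_ne_top.2 hc0))

/-- The error term does not depend on `A`, whence the uniformity over sets of states. -/
theorem ENNReal.tsum_indicator_le_add {α : Type*} (A : Set α) (f g : α → ℝ≥0∞) :
    ∑' a, A.indicator f a ≤ ∑' a, A.indicator g a + ∑' a, (f a - g a) := by
  rw [← ENNReal.tsum_add]
  refine ENNReal.tsum_le_tsum fun a => ?_
  by_cases h : a ∈ A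
  · simpa [h] using le_add_tsub
  · simp [h]

/-- If the laws of any two starting points merge, then they converge to the stationary law,
uniformly on all sets of states. -/
theorem IsStationaryLaw.tendsto_of_tvDist (hπ : IsStationaryLaw p π) (hp : IsStepFamily p)
    (h : ∀ x y, Tendsto (fun m => tvDist p m x y) atTop (𝓝 0)) (x : S) (A : Set S) :
    Tendsto (fun n => ∑' z, A.indicator (p n x) z) atTop (𝓝 (∑' z, A.indicator π z)) := by
  have hπ1 : ∑' y, π y ≠ ∞ := by rw [hπ.mass]; exact ENNReal.one_ne_top
  -- Both `p n x` and `π` become `π`-mixtures, so their difference is bounded by an average of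
  -- distances.
  have hconst : ∀ n z, p n x z = ∑' y, π y * p n x z := fun n z => by
    rw [ENNReal.tsum_mul_right, hπ.mass, one_mul]
  have hlow : ∀ n, ∑' z, (π z - p n x z) ≤ ∑' y, π y * tvDist p n y x := fun n => by
    simp_rw [tvDist, ← ENNReal.tsum_mul_left]
    rw [ENNReal.tsum_comm]
    refine ENNReal.tsum_le_tsum fun z => ?_
    rw [← hπ.steps hp n z, hconst n z]
    refine (ENNReal.tsum_tsub_tsum_le _ _).trans (ENNReal.tsum_le_tsum fun y => ?_)
    rw [← hconst]
    exact ENNReal.mul_tsub_mul_le _ _ _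
  have hupp : ∀ n, ∑' z, (p n x z - π z) ≤ ∑' y, π y * tvDist p n x y := fun n => by
    simp_rw [tvDist, ← ENNReal.tsum_mul_left]
    rw [ENNReal.tsum_comm]
    refine ENNReal.tsum_le_tsum fun z => ?_
    rw [← hπ.steps hp n z, hconst n z]
    refine (ENNReal.tsum_tsub_tsum_le _ _).trans (ENNReal.tsum_le_tsum fun y => ?_)
    rw [← hconst]
    exact ENNReal.mul_tsub_mul_le _ _ _
  have hlow0 := ENNReal.tendsto_tsum_mul_of_le_one hπ1
    (u := fun n y => tvDist p n y x) (fun n y => hp.tvDist_le_one n y x) (fun y => h y x)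
  have hupp0 := ENNReal.tendsto_tsum_mul_of_le_one hπ1
    (u := fun n y => tvDist p n x y) (fun n y => hp.tvDist_le_one n x y) (fun y => h x y)
  have hAt : ∑' z, A.indicator π z ≠ ∞ :=
    ne_top_of_le_ne_top hπ1 (ENNReal.tsum_le_tsum fun z => Set.indicator_le_self A π z)
  refine tendsto_of_tendsto_of_tendsto_of_le_of_le
    (g := fun n => ∑' z, A.indicator π z - ∑' y, π y * tvDist p n y x)
    (h := fun n => ∑' z, A.indicator π z + ∑' y, π y * tvDist p n x y) ?_ ?_ (fun n => ?_)
    (fun n => ?_)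
  · simpa using ENNReal.Tendsto.sub tendsto_const_nhds hlow0 (Or.inl hAt)
  · simpa using tendsto_const_nhds.add hupp0
  · rw [tsub_le_iff_right]
    exact (ENNReal.tsum_indicator_le_add A π (p n x)).trans (add_le_add le_rfl (hlow n))
  · exact (ENNReal.tsum_indicator_le_add A (p n x) π).trans (add_le_add le_rfl (hupp n))

/-- If the period of `j` is one, then returns to `j` have positive probability at all large
times. -/
theorem IsStepFamily.eventually_return_pos (hp : IsStepFamily p) {j : S}
    (h : Nat.setGcd {n | 1 ≤ n ∧ 0 < p n j j} = 1) : ∀ᶠ n in atTop, 0 < p n j j := by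
  -- All large multiples of the gcd lie in the additive monoid generated by the set, and possible
  -- return times are closed under addition.
  obtain ⟨N, hN⟩ := Nat.exists_mem_closure_of_ge {n | 1 ≤ n ∧ 0 < p n j j}
  filter_upwards [eventually_ge_atTop N] with n hn
  have hmem := hN n hn (by rw [h]; exact one_dvd n)
  clear hn
  induction hmem using AddSubmonoid.closure_induction with
  | mem n hn => exact hn.2
  | zero => simp [hp.zero]
  | add a b _ _ ha hb => exact hp.pos_add ha hb

/-- Convergence to the stationary law of irreducible aperiodic chains. -/
theorem IsStationaryLaw.tendsto (hπ : IsStationaryLaw p π) (hp : IsStepFamily p)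
    (hirr : ∀ x y, ∃ n, 0 < p n x y) {j : S} (hj : 0 < π j)
    (hper : Nat.setGcd {n | 1 ≤ n ∧ 0 < p n j j} = 1) (x : S) (A : Set S) :
    Tendsto (fun n => ∑' z, A.indicator (p n x) z) atTop (𝓝 (∑' z, A.indicator π z)) := by
  refine hπ.tendsto_of_tvDist hp (fun x y => ?_) x A
  obtain ⟨N, hN⟩ := eventually_atTop.1 (hp.eventually_return_pos hper)
  obtain ⟨k, hk⟩ := hirr j x
  obtain ⟨l, hl⟩ := hirr j y
  -- Loops at `j` of lengths `N + l` and `N + k` equalise the lengths of the paths to `x` and `y`.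
  have hx := hp.pos_add (hN (N + l) (by omega)) hk
  have hy := hp.pos_add (hN (N + k) (by omega)) hl
  rw [show N + k + l = N + l + k by omega] at hy
  exact hπ.tendsto_tvDist hp hj hx hy

end

/-! ### The stationary law of a positive recurrent state -/

/-- The probability that the chain started at `j` is at `k` at time `n` without a visit to `j`
at the times `1, …, n`. -/
noncomputable def tabooProb {S : Type*} (P : Matrix S S ℝ) (j : S) : ℕ → S → ℝ≥0∞
  | 0, k => if k = j then 1 else 0
  | n + 1, k => if k = j then 0 else ∑' i, tabooProb P j n i * ENNReal.ofReal (P i k)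

section
variable {S : Type*} {P : Matrix S S ℝ} {j : S}

/-- A first return at time `n + m + 1` is split at the position at time `n`; the induction moves one
step at a time from the second factor to the first. -/
theorem tsum_tabooProb_mul_firstPassageProb (n m : ℕ) :
    ∑' i, tabooProb P j n i * firstPassageProb P j (m + 1) i =
      firstPassageProb P j (n + m + 1) j := by
  induction n generalizing m with
  | zero => simp [tabooProb, tsum_ite_eq]
  | succ n ih =>
    rw [show n + 1 + m + 1 = n + (m + 1) + 1 by omega, ← ih (m + 1)]
    simp only [tabooProb, firstPassageProb]
    calc _ = ∑' k, ∑' i, tabooProb P j n i *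
            (if k = j then 0 else ENNReal.ofReal (P i k) * firstPassageProb P j (m + 1) k) := by
          refine tsum_congr fun k => ?_
          split_ifs
          · simp
          · rw [← ENNReal.tsum_mul_right]
            exact tsum_congr fun i => by ring
      _ = _ := by
          rw [ENNReal.tsum_comm]
          exact tsum_congr fun i => by rw [ENNReal.tsum_mul_left]

theorem tsum_tabooProb_mul (n : ℕ) :
    ∑' i, tabooProb P j n i * ENNReal.ofReal (P i j) = firstPassageProb P j (n + 1) j := by
  have := tsum_tabooProb_mul_firstPassageProb (P := P) (j := j) n 0
  simpa [firstPassageProb] using this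

theorem tsum_tabooProb_step (n : ℕ) (k : S) :
    ∑' i, tabooProb P j n i * ENNReal.ofReal (P i k) =
      (if k = j then firstPassageProb P j (n + 1) j else 0) + tabooProb P j (n + 1) k := by
  rw [tabooProb]
  split_ifs with h
  · rw [h, tsum_tabooProb_mul, add_zero]
  · rw [zero_add]

theorem tsum_tabooProb_succ (hP : ∀ i, ∑' k, ENNReal.ofReal (P i k) = 1) (n : ℕ) :
    ∑' k, tabooProb P j n k =
      firstPassageProb P j (n + 1) j + ∑' k, tabooProb P j (n + 1) k := by
  calc ∑' k, tabooProb P j n k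
      = ∑' i, ∑' k, tabooProb P j n i * ENNReal.ofReal (P i k) :=
        tsum_congr fun i => by rw [ENNReal.tsum_mul_left, hP, mul_one]
    _ = _ := by
        rw [ENNReal.tsum_comm]
        simp_rw [tsum_tabooProb_step]
        rw [ENNReal.tsum_add, tsum_ite_eq]

theorem sum_firstPassageProb_add_tsum_tabooProb (hP : ∀ i, ∑' k, ENNReal.ofReal (P i k) = 1)
    (n : ℕ) :
    ∑ m ∈ Finset.range (n + 1), firstPassageProb P j m j + ∑' k, tabooProb P j n k = 1 := by
  induction n with
  | zero => simp [tabooProb, firstPassageProb, tsum_ite_eq]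
  | succ n ih => rw [Finset.sum_range_succ, add_assoc, ← tsum_tabooProb_succ hP, ih]

/-- Both sides are the probability that the return time exceeds `n`, because a return is certain. -/
theorem tsum_tabooProb_eq (hP : ∀ i, ∑' k, ENNReal.ofReal (P i k) = 1)
    (hj : ∑' n, firstPassageProb P j n j = 1) (n : ℕ) :
    ∑' k, tabooProb P j n k = ∑' m, if n < m then firstPassageProb P j m j else 0 := by
  have h := sum_firstPassageProb_add_tsum_tabooProb (j := j) hP n
  have hsplit : ∑ m ∈ Finset.range (n + 1), firstPassageProb P j m j +
      ∑' m, (if n < m then firstPassageProb P j m j else 0) = 1 := by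
    rw [← hj, show ∑ m ∈ Finset.range (n + 1), firstPassageProb P j m j =
      ∑' m, if n < m then 0 else firstPassageProb P j m j from ?_, ← ENNReal.tsum_add]
    · exact tsum_congr fun m => by split_ifs <;> simp
    · rw [tsum_eq_sum (s := Finset.range (n + 1)) fun m hm => if_pos (by simpa using hm)]
      exact Finset.sum_congr rfl fun m hm => (if_neg (by simp at hm; omega)).symm
  have hfin : ∑ m ∈ Finset.range (n + 1), firstPassageProb P j m j ≠ ∞ :=
    ne_top_of_le_ne_top ENNReal.one_ne_top (h ▸ le_self_add)
  exact (ENNReal.add_right_inj hfin).1 (h.trans hsplit.symm)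

/-- The expected number of steps before the return to `j` is the mean return time. -/
theorem tsum_tsum_tabooProb (hP : ∀ i, ∑' k, ENNReal.ofReal (P i k) = 1)
    (hj : ∑' n, firstPassageProb P j n j = 1) :
    ∑' k, ∑' n, tabooProb P j n k = ∑' n : ℕ, (n : ℝ≥0∞) * firstPassageProb P j n j := by
  rw [ENNReal.tsum_comm]
  simp_rw [tsum_tabooProb_eq hP hj]
  rw [ENNReal.tsum_comm]
  refine tsum_congr fun m => ?_
  -- A return at time `m` is counted once for each of the `m` times `n < m`.
  rw [tsum_eq_sum (s := Finset.range m) fun n hn => if_neg (by simpa using hn),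
    Finset.sum_congr rfl fun n hn => if_pos (by simpa using hn)]
  simp

/-- The occupation measure of an excursion from a recurrent state is invariant. -/
theorem tsum_occupation_mul (hj : ∑' n, firstPassageProb P j n j = 1) (k : S) :
    ∑' i, (∑' n, tabooProb P j n i) * ENNReal.ofReal (P i k) = ∑' n, tabooProb P j n k := by
  simp_rw [← ENNReal.tsum_mul_right]
  rw [ENNReal.tsum_comm]
  simp_rw [tsum_tabooProb_step]
  rw [ENNReal.tsum_add, tsum_eq_zero_add' (f := fun n => tabooProb P j n k) ENNReal.summable]
  -- At `k = j` the returns, of total mass one by `hj`, replace the unit mass at time `0`.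
  congr 1
  rw [tabooProb]
  split_ifs
  · rw [← hj, tsum_eq_zero_add' (f := fun n => firstPassageProb P j n j) ENNReal.summable]
    simp [firstPassageProb]
  · simp

theorem one_le_occupation : 1 ≤ ∑' n, tabooProb P j n j :=
  le_trans (by simp [tabooProb]) (ENNReal.le_tsum 0)

/-- A positive recurrent state carries a stationary law. -/
theorem IsPositiveRecurrentState.exists_isStationaryLaw {p : ℕ → S → S → ℝ≥0∞}
    (hp : IsStepFamily p) (hP : ∀ i k, p 1 i k = ENNReal.ofReal (P i k))
    (hj : IsPositiveRecurrentState P j) : ∃ π, IsStationaryLaw p π ∧ 0 < π j := by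
  have hmass : ∀ i, ∑' k, ENNReal.ofReal (P i k) = 1 := fun i => by
    simp_rw [← hP]
    exact hp.mass 1 i
  set ρ : S → ℝ≥0∞ := fun k => ∑' n, tabooProb P j n k with hρ
  have htot : ∑' k, ρ k ≠ ∞ := by
    rw [hρ, tsum_tsum_tabooProb hmass hj.1]
    exact hj.2.ne
  have hρj : 1 ≤ ρ j := one_le_occupation
  have htot0 : ∑' k, ρ k ≠ 0 := fun h =>
    absurd (hρj.trans (ENNReal.tsum_eq_zero.1 h j).le) (by simp)
  refine ⟨fun k => (∑' k, ρ k)⁻¹ * ρ k, ⟨?_, fun k => ?_⟩, ?_⟩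
  · rw [ENNReal.tsum_mul_left, ENNReal.inv_mul_cancel htot0 htot]
  · simp_rw [mul_assoc, hP]
    rw [ENNReal.tsum_mul_left, hρ, tsum_occupation_mul hj.1]
  · exact ENNReal.mul_pos (ENNReal.inv_ne_zero.2 htot) (one_pos.trans_le hρj).ne'

end

/-! ### The emulation process as a Markov chain -/

theorem Computer.emulated_nil (C : Computer) : C.emulated [] = C := rfl

theorem Computer.emulated_emulated (C : Computer) (x y : List Bool) :
    (C.emulated x).emulated y = C.emulated (x ++ y) := by
  apply Subtype.ext
  funext s
  simp [Computer.emulated]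

theorem Computer.emulated_apply_nil (C : Computer) (x : List Bool) :
    (C.emulated x).1 [] = C.1 x := by
  simp [Computer.emulated]

theorem mem_emulationTree {Φ : Set Computer} {C : Computer} {x : List Bool} :
    x ∈ emulationTree Φ C ↔ C.emulated x ∈ Φ := Iff.rfl

theorem append_mem_emulationTree {Φ : Set Computer} {C : Computer} {x y : List Bool} :
    x ++ y ∈ emulationTree Φ C ↔ y ∈ emulationTree Φ (C.emulated x) := by
  simp only [mem_emulationTree, Computer.emulated_emulated]

theorem pathProb_nonneg (T : Set (List Bool)) (x : List Bool) : 0 ≤ pathProb T x := by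
  induction x using List.reverseRecOn with
  | nil => simp [pathProb_nil]
  | append_singleton x b ih =>
    rw [pathProb_append_singleton]
    split_ifs <;> positivity

theorem pathProb_append (Φ : Set Computer) (C : Computer) (x y : List Bool) :
    pathProb (emulationTree Φ C) (x ++ y) =
      pathProb (emulationTree Φ C) x * pathProb (emulationTree Φ (C.emulated x)) y := by
  induction y using List.reverseRecOn with
  | nil => simp [pathProb_nil]
  | append_singleton y b ih =>
    rw [← List.append_assoc, pathProb_append_singleton, pathProb_append_singleton, ih,
      List.append_assoc, append_mem_emulationTree]
    split_ifs <;> ring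

theorem List.Vector.sum_append {α M : Type*} [Fintype α] [AddCommMonoid M] (m n : ℕ)
    (f : List α → M) :
    ∑ v : List.Vector α (m + n), f v.toList =
      ∑ x : List.Vector α m, ∑ y : List.Vector α n, f (x.toList ++ y.toList) := by
  rw [← Fintype.sum_prod_type' (f := fun (x : List.Vector α m) (y : List.Vector α n) =>
    f (x.toList ++ y.toList))]
  refine (Function.Bijective.sum_comp 
    (e := fun q : List.Vector α m × List.Vector α n =>
      show List.Vector α (m + n) from ⟨q.1.toList ++ q.2.toList, by simp⟩) ?_
    (fun v : List.Vector α (m + n) => f v.toList)).symm.trans ?_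
  · rw [Fintype.bijective_iff_injective_and_card]
    refine ⟨fun q r h => ?_, by simp [pow_add]⟩
    obtain ⟨h₁, h₂⟩ := List.append_inj (congrArg Subtype.val h) (by simp)
    exact Prod.ext (List.Vector.toList_injective h₁) (List.Vector.toList_injective h₂)
  · rfl

theorem List.Vector.sum_zero {α M : Type*} [Fintype α] [AddCommMonoid M] (f : List α → M) :
    ∑ v : List.Vector α 0, f v.toList = f [] :=
  Fintype.sum_eq_single List.Vector.nil fun v h => (h (List.Vector.eq_nil v)).elim

/-- Each path ends at one computer only, so summing over the states in `Φ` just tests whether that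
computer lies in `Φ`. -/
theorem tsum_subtype_ite_eq {α : Type*} (s : Set α) (a : α)
    [∀ b : s, Decidable (a = b)] [Decidable (a ∈ s)] (f : s → ℝ≥0∞) :
    ∑' b : s, (if a = b then f b else 0) = if h : a ∈ s then f ⟨a, h⟩ else 0 := by
  split_ifs with h
  · rw [tsum_eq_single ⟨a, h⟩ fun b hb => if_neg fun hab => hb (Subtype.ext hab.symm), if_pos rfl]
  · exact ENNReal.tsum_eq_zero.2 fun b => if_neg fun hab : a = b => h (hab ▸ b.2)

theorem List.Vector.sum_one {α M : Type*} [Fintype α] [AddCommMonoid M] (f : List α → M) :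
    ∑ v : List.Vector α 1, f v.toList = ∑ a, f [a] := by
  refine (Function.Bijective.sum_comp (e := fun a : α => a ::ᵥ List.Vector.nil) ?_
    (fun v => f v.toList)).symm.trans ?_
  · rw [Fintype.bijective_iff_injective_and_card]
    refine ⟨fun a b h => ?_, by simp⟩
    simpa using congrArg List.Vector.head h
  · simp

/-- The path probability of `x` in the tree of `C`, as an extended nonnegative real. -/
noncomputable def pathWeight (Φ : Set Computer) (C : Computer) (x : List Bool) : ℝ≥0∞ :=
  ENNReal.ofReal (pathProb (emulationTree Φ C) x)

theorem pathWeight_append (Φ : Set Computer) (C : Computer) (x y : List Bool) :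
    pathWeight Φ C (x ++ y) = pathWeight Φ C x * pathWeight Φ (C.emulated x) y := by
  rw [pathWeight, pathProb_append, ENNReal.ofReal_mul (pathProb_nonneg _ _)]
  rfl

theorem computerProb_nonneg (Φ : Set Computer) (C : Computer) (n : ℕ) (D : Computer) :
    0 ≤ computerProb Φ C n D :=
  Finset.sum_nonneg fun _ _ => pathProb_nonneg _ _

theorem stringProb_nonneg (Φ : Set Computer) (C : Computer) (n : ℕ) (s : Part (List Bool)) :
    0 ≤ stringProb Φ C n s :=
  Finset.sum_nonneg fun _ _ => pathProb_nonneg _ _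

/-- The `n`-step transition probabilities of the emulation Markov process. -/
noncomputable def stepProb (Φ : Set Computer) (n : ℕ) (C D : Φ) : ℝ≥0∞ :=
  ENNReal.ofReal (computerProb Φ C n D)

theorem stepProb_eq_sum (Φ : Set Computer) (n : ℕ) (C D : Φ) :
    stepProb Φ n C D = ∑ x : List.Vector Bool n,
      if C.1.emulated x.toList = D then pathWeight Φ C x.toList else 0 := by
  rw [stepProb, computerProb, ENNReal.ofReal_sum_of_nonneg fun _ _ => pathProb_nonneg _ _,
    Finset.sum_filter]
  rfl

/-- Chapman–Kolmogorov: inputs of length `m + n` are cut after `m` bits. -/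
theorem stepProb_add {Φ : Set Computer} (hΦ : IsBranchingSet Φ) (m n : ℕ) (C D : Φ) :
    stepProb Φ (m + n) C D = ∑' U, stepProb Φ m C U * stepProb Φ n U D := by
  rw [stepProb_eq_sum, List.Vector.sum_append m n fun v =>
    if C.1.emulated v = D then pathWeight Φ C v else 0]
  simp_rw [stepProb_eq_sum Φ m, Finset.sum_mul]
  rw [Summable.tsum_finsetSum fun _ _ => ENNReal.summable]
  refine Finset.sum_congr rfl fun x _ => ?_
  simp_rw [ite_mul, zero_mul]
  rw [tsum_subtype_ite_eq]
  split_ifs with hx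
  · rw [stepProb_eq_sum, Finset.mul_sum]
    refine Finset.sum_congr rfl fun y _ => ?_
    simp only [Computer.emulated_emulated, pathWeight_append, mul_ite, mul_zero]
  -- A path that is outside `Φ` after `m` bits cannot end at `D ∈ Φ`, since the tree is closed under
  -- prefixes.
  · refine Finset.sum_eq_zero fun y _ => if_neg fun h => hx ?_
    exact hΦ.prefix_mem C C.2 _ y.toList (h ▸ D.2)

/-- The walk never gets stuck: the first bit of a nonempty element of the tree is itself in the
tree. The mass is then `1` or `1/2 + 1/2`. -/
theorem tsum_stepProb_one {Φ : Set Computer} (hΦ : IsBranchingSet Φ) (C : Φ) :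
    ∑' D, stepProb Φ 1 C D = 1 := by
  have hsum : ∑' D, stepProb Φ 1 C D =
      ∑ b : Bool, if [b] ∈ emulationTree Φ C then pathWeight Φ C [b] else 0 := by
    simp_rw [stepProb_eq_sum]
    rw [Summable.tsum_finsetSum fun _ _ => ENNReal.summable, ← List.Vector.sum_one fun v =>
      if v ∈ emulationTree Φ C then pathWeight Φ C v else 0]
    refine Finset.sum_congr rfl fun x _ => ?_
    rw [tsum_subtype_ite_eq]
    simp [mem_emulationTree]
  have hweight : ∀ b, pathWeight Φ C [b] = if [!b] ∈ emulationTree Φ C then 2⁻¹ else 1 := by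
    intro b
    have := pathProb_append_singleton (emulationTree Φ C) [] b
    rw [List.nil_append, List.nil_append, pathProb_nil] at this
    rw [pathWeight, this]
    split_ifs
    · rw [mul_one, one_div, ENNReal.ofReal_inv_of_pos two_pos, ENNReal.ofReal_ofNat]
    · exact ENNReal.ofReal_one
  have hex : ∃ b, [b] ∈ emulationTree Φ C := by
    obtain ⟨x, hx, hxΦ⟩ := hΦ.exists_mem C C.2
    obtain ⟨b, y, rfl⟩ := List.exists_cons_of_ne_nil hx
    exact ⟨b, hΦ.prefix_mem C C.2 [b] y hxΦ⟩
  rw [hsum, Fintype.sum_bool, hweight, hweight]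
  obtain ⟨b, hb⟩ := hex
  by_cases ht : [true] ∈ emulationTree Φ C <;> by_cases hf : [false] ∈ emulationTree Φ C <;>
    simp [ht, hf, ENNReal.inv_two_add_inv_two]
  cases b <;> contradiction

theorem IsBranchingSet.isStepFamily {Φ : Set Computer} (hΦ : IsBranchingSet Φ) :
    IsStepFamily (stepProb Φ) := by
  have hzero : ∀ C D : Φ, stepProb Φ 0 C D = if D = C then 1 else 0 := fun C D => by
    rw [stepProb_eq_sum, List.Vector.sum_zero fun v =>
      if C.1.emulated v = D then pathWeight Φ C v else 0]
    simp [Computer.emulated_nil, pathWeight, pathProb_nil, Subtype.ext_iff, eq_comm]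
  refine ⟨fun C D => by rw [hzero]; congr, stepProb_add hΦ, fun n C => ?_⟩
  induction n with
  | zero => simp [hzero]
  | succ n ih =>
    simp_rw [stepProb_add hΦ]
    rw [ENNReal.tsum_comm]
    simp_rw [ENNReal.tsum_mul_left, tsum_stepProb_one hΦ, mul_one]
    exact ih

/-- The string probability of `s` is the probability of the computers with output `s` at `λ`. -/
theorem ofReal_stringProb (Φ : Set Computer) (n : ℕ) (C : Φ) (s : Part (List Bool)) :
    ENNReal.ofReal (stringProb Φ C n s) =
      ∑' U, {U : Φ | U.1.1 [] = s}.indicator (stepProb Φ n C) U := by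
  rw [stringProb, ENNReal.ofReal_sum_of_nonneg fun _ _ => pathProb_nonneg _ _, Finset.sum_filter]
  have hU : ∀ U : Φ, {U : Φ | U.1.1 [] = s}.indicator (stepProb Φ n C) U =
      ∑ x : List.Vector Bool n, if C.1.emulated x.toList = U then
        if U.1.1 [] = s then pathWeight Φ C x.toList else 0 else 0 := fun U => by
    by_cases h : U.1.1 [] = s <;> simp [stepProb_eq_sum, h]
  simp_rw [hU]
  rw [Summable.tsum_finsetSum fun _ _ => ENNReal.summable]
  refine Finset.sum_congr rfl fun x _ => ?_
  rw [tsum_subtype_ite_eq]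
  by_cases hx : C.1.emulated x.toList ∈ Φ <;>
    simp [mem_emulationTree, hx, Computer.emulated_apply_nil, pathWeight]

theorem stringProb_zero {Φ : Set Computer} {C : Computer} (hC : C ∈ Φ) (s : Part (List Bool)) :
    stringProb Φ C 0 s = if C.1 [] = s then 1 else 0 := by
  rw [stringProb, Finset.sum_filter, List.Vector.sum_zero fun v =>
    if v ∈ emulationTree Φ C ∧ C.1 v = s then pathProb (emulationTree Φ C) v else 0]
  simp [mem_emulationTree, Computer.emulated_nil, hC, pathProb_nil]

/-! ### Limits of computer and string probabilities -/

theorem IsPositiveRecurrentSet.exists_law {Φ : Set Computer} (hΦ : IsPositiveRecurrentSet Φ)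
    (hne : Φ.Nonempty) : ∃ π : Φ → ℝ≥0∞, ∑' U, π U = 1 ∧ ∀ (C : Φ) (A : Set Φ),
      Tendsto (fun n => ∑' U, A.indicator (stepProb Φ n C) U) atTop
        (𝓝 (∑' U, A.indicator π U)) := by
  obtain ⟨J, hJ⟩ := hne
  have hp := hΦ.branching.isStepFamily
  obtain ⟨π, hπ, hj⟩ :=
    (hΦ.recurrent ⟨J, hJ⟩).exists_isStationaryLaw hp fun _ _ => rfl
  refine ⟨π, hπ.mass, fun C A => hπ.tendsto hp (fun U V => ?_) hj ?_ C A⟩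
  · obtain ⟨n, hn⟩ := hΦ.irreducible U U.2 V V.2
    exact ⟨n, ENNReal.ofReal_pos.2 hn⟩
  · simpa [stepProb, emulationPeriod] using hΦ.aperiodic J hJ

theorem theorem4p2 (Φ : Set Computer) (hΦ : IsPositiveRecurrentSet Φ) :
    -- `μ D` is the computer probability of `D`, the limit of its `n`-step probabilities
    ∃ μ : Computer → ℝ,
      (∀ C ∈ Φ, ∀ D ∈ Φ, Tendsto (fun n : ℕ => computerProb Φ C n D) atTop (𝓝 (μ D))) ∧
      ∀ s : Part (List Bool), ∃ p : ℝ,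
        (∀ C ∈ Φ, Tendsto (fun n : ℕ => stringProb Φ C n s) atTop (𝓝 p)) ∧
        HasSum (fun U : Φ => μ U * stringProb Φ U 0 s) p ∧
        HasSum (fun U : {U : Computer // U ∈ Φ ∧ U.1 [] = s} => μ U) p := by
  -- An empty `Φ` has no state to carry a stationary law; there all claims are vacuous or about
  -- empty sums.
  obtain rfl | hne := Φ.eq_empty_or_nonempty
  · refine ⟨0, by simp, fun s => ⟨0, by simp, ?_, ?_⟩⟩
    · simp
    · simp
  obtain ⟨π, hmass, hlim⟩ := hΦ.exists_law hne
  have htop : ∑' U, π U ≠ ∞ := by rw [hmass]; exact ENNReal.one_ne_top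
  have hAtop : ∀ A : Set Φ, ∑' U, A.indicator π U ≠ ∞ := fun A =>
    ne_top_of_le_ne_top htop (ENNReal.tsum_le_tsum fun U => Set.indicator_le_self A π U)
  set μ : Computer → ℝ := fun D => if h : D ∈ Φ then (π ⟨D, h⟩).toReal else 0
  have hμ : ∀ U : Φ, μ U = (π U).toReal := fun U => dif_pos U.2
  refine ⟨μ, fun C hC D hD => ?_, fun s => ?_⟩
  -- Computers are the case of singletons; strings below use the set of computers with output `s`.
  · have h := (ENNReal.tendsto_toReal (hAtop {⟨D, hD⟩})).comp (hlim ⟨C, hC⟩ {⟨D, hD⟩})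
    simp only [Function.comp_def, Set.indicator_apply, Set.mem_singleton_iff, tsum_ite_eq] at h
    rw [← hμ ⟨D, hD⟩] at h
    exact h.congr fun n => ENNReal.toReal_ofReal (computerProb_nonneg _ _ _ _)
  set A : Set Φ := {U | U.1.1 [] = s}
  have hsum : HasSum (A.indicator fun U => μ U) (∑' U, A.indicator π U).toReal := by
    rw [ENNReal.tsum_toReal_eq (fun U => ENNReal.ne_top_of_tsum_ne_top (hAtop A) U)]
    have h := (ENNReal.summable_toReal (hAtop A)).hasSum
    convert h using 2 with U
    rw [Set.indicator_apply, Set.indicator_apply, apply_ite ENNReal.toReal, hμ,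
      ENNReal.toReal_zero]
  refine ⟨(∑' U, A.indicator π U).toReal, fun C hC => ?_, ?_, ?_⟩
  · have h := (ENNReal.tendsto_toReal (hAtop A)).comp (hlim ⟨C, hC⟩ A)
    refine h.congr fun n => ?_
    rw [Function.comp_apply, ← ofReal_stringProb,
      ENNReal.toReal_ofReal (stringProb_nonneg _ _ _ _)]
  · convert hsum using 2 with U
    rw [stringProb_zero U.2, Set.indicator_apply, mul_ite, mul_one, mul_zero]
    rfl
  · rw [← hasSum_subtype_iff_indicator] at hsum
    exact (Equiv.subtypeSubtypeEquivSubtypeInter (· ∈ Φ)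
      (fun U : Computer => U.1 [] = s)).hasSum_iff.1 hsum
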